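/- The square grid is the graph with vertex set $\mathbb{Z}^2$ in which $\mathbf{u}$ and $\mathbf{v}$ are adjacent if and only if $\mathbf{u}-\mathbf{v}\in\{(\pm1,0),(0,\pm1)\}$. Let $D\subseteq\mathbb{Z}^2$ be the closed $1$-neighborhood of $\mathbf{0}$ in the square grid, that is, the set of vertices at distance at most $1$ from $\mathbf{0}$, and let $a,b$ be non-negative integers with $b-a\neq 1$. A $(D,b,a)$-covering is a configuration $c\in\{0,1\}^{\mathbb{Z}^2}$ such that, for every $\mathbf{u}\in\mathbb{Z}^2$, the number of $\mathbf{w}\in\mathbf{u}+D$ with $c(\mathbf{w})=1$ is exactly $b$ if $c(\mathbf{u})=1$ and exactly $a$ if $c(\mathbf{u})=0$. A function $c$ on $\mathbb{Z}^2$ is two-periodic if there are linearly independent $\mathbf{t}_1,\mathbf{t}_2\in\mathbb{Z}^2$ with $c(\mathbf{u}-\mathbf{t}_i)=c(\mathbf{u})$ for all $\mathbf{u}\in\mathbb{Z}^2$ and $i=1,2$. Then every $(D,b,a)$-covering $c$ is two-periodic. Moreover, let $f_D=\sum_{\mathbf{u}\in D}X^{-\mathbf{u}}$, a Laurent polynomial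 in two variables with complex coefficients. For every $(D,b,a)$-covering $c$, the Laurent polynomial $f_D-(b-a)$ is a periodizer of $c$: the formal product of $f_D-(b-a)$ and the power series $\sum_{\mathbf{u}\in\mathbb{Z}^2}c(\mathbf{u})X^{\mathbf{u}}$ has two-periodic coefficients. Furthermore, $f_D-(b-a)$ has no line polynomial factor in the ring $\mathbb{C}[x^{\pm1},y^{\pm1}]$, where a line polynomial is a Laurent polynomial whose support $\{\mathbf{u}:\text{the coefficient of }X^{\mathbf{u}}\text{ is nonzero}\}$ has at least two points and is contained in $\mathbf{u}_0+\mathbb{Q}\mathbf{v}$ for some $\mathbf{u}_0,\mathbf{v}\in\mathbb{Z}^2$. -/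

import Mathlib

namespace GridCovering

/-! ### Configurations and periodicity -/

/-- The translation by `t`: `translate t c u = c (u - t)`. -/
def translate {A : Type*} (t : ℤ × ℤ) (c : ℤ × ℤ → A) : ℤ × ℤ → A :=
  fun u => c (u - t)

/-- `c` is `t`-periodic. -/
def IsPeriodicBy {A : Type*} (c : ℤ × ℤ → A) (t : ℤ × ℤ) : Prop :=
  translate t c = c

/-- `c` is two-periodic (strongly periodic): it has two linearly independent
vectors of periodicity. -/
def IsTwoPeriodic {A : Type*} (c : ℤ × ℤ → A) : Prop :=
  ∃ t₁ t₂ : ℤ × ℤ, LinearIndependent ℤ ![t₁, t₂] ∧ IsPeriodicBy c t₁ ∧ IsPeriodicBy c t₂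

/-- Binary configurations on the two-dimensional integer lattice. -/
abbrev BinaryConfig : Type := ℤ × ℤ → Fin 2

/-! ### The square grid and perfect coverings -/

/-- The square grid: `u` and `v` are adjacent iff `u - v` is one of `(±1, 0)`, `(0, ±1)`. -/
def squareGrid : SimpleGraph (ℤ × ℤ) where
  Adj u v := u - v ∈ ({(1, 0), (-1, 0), (0, 1), (0, -1)} : Set (ℤ × ℤ))
  symm := ⟨by
    rintro ⟨a, b⟩ ⟨c, d⟩ h
    simp only [Prod.mk_sub_mk, Set.mem_insert_iff, Set.mem_singleton_iff, Prod.mk.injEq] at h ⊢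
    omega⟩
  loopless := ⟨by
    intro u h
    simp only [sub_self, Set.mem_insert_iff, Set.mem_singleton_iff, Prod.ext_iff, Prod.fst_zero,
      Prod.snd_zero] at h
    omega⟩

/-- The closed `r`-neighborhood of `u` in a graph: all vertices at distance at most `r`
from `u`. Extended distance is used, so unreachable vertices are at distance `⊤`. -/
def neighborhood {V : Type*} (G : SimpleGraph V) (r : ℕ) (u : V) : Set V :=
  {v | G.edist v u ≤ r}

/-- `c` is a `(D, b, a)`-covering: for every cell `u`, the pattern of `c` on `u + D` contains
exactly `b` symbols `1` if `c u = 1`, and exactly `a` symbols `1` if `c u = 0`. -/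
def IsCovering (D : Finset (ℤ × ℤ)) (b a : ℕ) (c : BinaryConfig) : Prop :=
  ∀ u : ℤ × ℤ,
    (c u = 1 → (D.filter fun d => c (u + d) = 1).card = b) ∧
    (c u = 0 → (D.filter fun d => c (u + d) = 1).card = a)

/-! ### Laurent polynomials and formal power series in two variables -/

/-- Complex Laurent polynomials in two variables; `single u z` is the monomial `z X^u`. -/
abbrev LaurentPoly : Type := AddMonoidAlgebra ℂ (ℤ × ℤ)

/-- Two-sided formal power series in two variables, given by their coefficients. -/
abbrev Series : Type := ℤ × ℤ → ℂ

/-- The formal power series presenting a binary configuration. -/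
def BinaryConfig.toSeries (c : BinaryConfig) : Series := fun u => ((c u : ℕ) : ℂ)

/-- The formal product `f c` of a Laurent polynomial and a formal power series. -/
noncomputable def mulSeries (f : LaurentPoly) (c : Series) : Series :=
  fun u => ∑ w ∈ f.coeff.support, f.coeff w * c (u - w)

/-- `f` is a periodizer of `c`: the product `f c` is two-periodic. -/
def IsPeriodizer (f : LaurentPoly) (c : Series) : Prop :=
  IsTwoPeriodic (mulSeries f c)

/-- A line polynomial: its support has at least two points and is contained in
`u + ℚ v` for some integer vectors `u`, `v`. -/
def IsLinePolynomial (φ : LaurentPoly) : Prop :=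
  2 ≤ φ.coeff.support.card ∧
    ∃ u v : ℤ × ℤ, ∀ w ∈ φ.coeff.support, ∃ q : ℚ,
      (w.1 : ℚ) = u.1 + q * v.1 ∧ (w.2 : ℚ) = u.2 + q * v.2

/-- The characteristic polynomial `f_D = ∑_{u ∈ D} X^{-u}` of a finite set `D`. -/
noncomputable def charPoly (D : Finset (ℤ × ℤ)) : LaurentPoly :=
  ∑ u ∈ D, AddMonoidAlgebra.single (-u) (1 : ℂ)

/-- The polynomial `f_D - (b - a)`. -/
noncomputable def coveringPoly (D : Finset (ℤ × ℤ)) (b a : ℕ) : LaurentPoly :=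
  charPoly D - AddMonoidAlgebra.single 0 ((b : ℂ) - (a : ℂ))

end GridCovering

/-!
Let `S_k` be the operator sending a function on the lattice to the sum of its four translates by
`(±k, 0)` and `(0, ±k)`, and let `l = b - a - 1`, which is nonzero by hypothesis. The
`0/1`-valued integer function `n` of a covering satisfies `S_1 n = l n + a`, so each of its
differences `e = n(· + s) - n` is a bounded integer function with `S_1 e = l e`.

*Dilation.* Modulo a prime `p`, Frobenius turns `S_1 e = l e` into `S_p e = l e`; if `p` is large
compared with `l` and the values of `e`, the congruence is an equality
(`crossSum_prime_of_bounded`). Iterating, `S_k e = l e` for all `k` without small prime factors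
(`crossSum_of_coprime`), in particular for all `k = 1 + M j` where `M` is a suitable factorial.

*Averaging.* Take the mixed difference of `e` with steps `M` along both axes and sum the
equations for `k = 1 + M j` over `j < J`. The right-hand sides telescope and stay bounded, while
the left-hand side is `l J` times the mixed difference. As `l ≠ 0`, the mixed difference vanishes
(`mixed_difference_eq_zero`).

*Determinism.* Hence `g = e(· + (0, M)) - e` is horizontally periodic. Two consecutive rows
determine a solution of `S_1 g = l g`, and there are finitely many such pairs of rows, so `g` is
vertically periodic too (`exists_vertical_period`). A bounded function whose difference along a
line is periodic along the same line is itself periodic (`periodic_of_periodic_difference`).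
Applied first to `e` and then to `n`, this gives vertical periods, and exchanging the axes gives
horizontal ones (`exists_axis_periods`).

The periodizer property is the equation `S_1 n = l n + a` itself: the formal product is the
constant `a`. Finally, a line polynomial `φ` is homogeneous for the grading by a linear functional
vanishing on its direction, so it divides every homogeneous component of each of its multiples
(`dvd_component_of_dvd`). For each direction some component of
`x + x⁻¹ + y + y⁻¹ - l` is a nonzero monomial, where `l ≠ 0` matters for the directions that are
not axial, and a divisor of a monomial is a monomial
(`card_support_le_one_of_dvd_single`).
-/

namespace GridCovering

/-! ### Sums over crosses and the Frobenius map -/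

/-- The sum of `e` over the four points at distance `k` from `u` along the coordinate axes. -/
def crossSum {R : Type*} [Add R] (k : ℤ) (e : ℤ × ℤ → R) (u : ℤ × ℤ) : R :=
  e (u + (k, 0)) + e (u + (-k, 0)) + e (u + (0, k)) + e (u + (0, -k))

/-- Translations of functions on the lattice, as a representation of `ℤ × ℤ`. -/
def translationHom (R : Type*) [CommSemiring R] :
    Multiplicative (ℤ × ℤ) →* Module.End R (ℤ × ℤ → R) where
  toFun t := LinearMap.funLeft R R (fun u => u + t.toAdd)
  map_one' := by ext; simp
  map_mul' s t := by
    refine LinearMap.ext fun e => funext fun u => ?_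
    simp [LinearMap.funLeft_apply, add_assoc]

/-- The Laurent polynomial `x ^ k + x ^ (-k) + y ^ k + y ^ (-k)`, which acts as `crossSum k`. -/
noncomputable def crossPoly (R : Type*) [CommSemiring R] (k : ℤ) : AddMonoidAlgebra R (ℤ × ℤ) :=
  .single (k, 0) 1 + .single (-k, 0) 1 + .single (0, k) 1 + .single (0, -k) 1

theorem lift_crossPoly {R : Type*} [CommSemiring R] (k : ℤ) (e : ℤ × ℤ → R) :
    AddMonoidAlgebra.lift R _ (ℤ × ℤ) (translationHom R) (crossPoly R k) e = crossSum k e := by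
  ext u
  simp [crossPoly, crossSum, AddMonoidAlgebra.lift_single, translationHom,
    LinearMap.funLeft_apply]

theorem crossPoly_pow (p : ℕ) [Fact p.Prime] (k : ℤ) :
    crossPoly (ZMod p) k ^ p = crossPoly (ZMod p) (p * k) := by
  have : CharP (AddMonoidAlgebra (ZMod p) (ℤ × ℤ)) p :=
    charP_of_injective_algebraMap
      (algebraMap (ZMod p) (AddMonoidAlgebra (ZMod p) (ℤ × ℤ))).injective p
  simp [crossPoly, add_pow_char, AddMonoidAlgebra.single_pow]

/-- By Frobenius, an eigenfunction of `crossSum 1` with values in `ZMod p` is an eigenfunction of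
`crossSum p` for the same eigenvalue. -/
theorem crossSum_prime_of_eigen (p : ℕ) [Fact p.Prime] {e : ℤ × ℤ → ZMod p} {l : ZMod p}
    (h : ∀ u, crossSum 1 e u = l * e u) (u : ℤ × ℤ) : crossSum p e u = l * e u := by
  set A := AddMonoidAlgebra.lift (ZMod p) _ (ℤ × ℤ) (translationHom (ZMod p))
  have h1 : A (crossPoly (ZMod p) 1) e = l • e := by
    rw [lift_crossPoly]; ext u; simp [h u]
  have h2 : ∀ n : ℕ, (A (crossPoly (ZMod p) 1) ^ n) e = l ^ n • e := by
    intro n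
    induction n with
    | zero => simp
    | succ n ih => rw [pow_succ, Module.End.mul_apply, h1, map_smul, ih, smul_smul, pow_succ']
  have h3 := h2 p
  rw [← map_pow, crossPoly_pow, lift_crossPoly, mul_one, ZMod.pow_card] at h3
  simpa using congrFun h3 u

/-- An integer eigenfunction with small values: the congruence modulo a large prime given by
Frobenius is an equality. -/
theorem crossSum_prime_of_bounded {e : ℤ × ℤ → ℤ} {l B : ℤ} (hB : ∀ u, |e u| ≤ B)
    (h : ∀ u, crossSum 1 e u = l * e u) {p : ℕ} (hp : p.Prime) (hpB : (4 + |l|) * B < p)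
    (u : ℤ × ℤ) : crossSum p e u = l * e u := by
  have := Fact.mk hp
  have h1 : ∀ u, crossSum 1 (fun v => (e v : ZMod p)) u = (l : ZMod p) * (e u : ZMod p) := by
    intro u
    have := congrArg (Int.cast : ℤ → ZMod p) (h u)
    simpa [crossSum] using this
  have h2 := crossSum_prime_of_eigen p h1 u
  have h3 : ((crossSum p e u - l * e u : ℤ) : ZMod p) = 0 := by
    rw [Int.cast_sub, sub_eq_zero]
    simpa [crossSum] using h2
  rw [ZMod.intCast_zmod_eq_zero_iff_dvd] at h3
  refine sub_eq_zero.mp (Int.eq_zero_of_abs_lt_dvd h3 (lt_of_le_of_lt ?_ hpB))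
  have h4 : |l * e u| ≤ |l| * B := by
    rw [abs_mul]; exact mul_le_mul_of_nonneg_left (hB u) (abs_nonneg l)
  have e1 := hB (u + ((p : ℤ), 0))
  have e2 := hB (u + (-(p : ℤ), 0))
  have e3 := hB (u + (0, (p : ℤ)))
  have e4 := hB (u + (0, -(p : ℤ)))
  rw [abs_le] at *
  unfold crossSum
  constructor <;> linarith

/-- Iterating over the prime factors, using that restricting to a dilated sublattice turns
`crossSum (m * p)` into `crossSum p`. -/
theorem crossSum_of_coprime {e : ℤ × ℤ → ℤ} {l B : ℤ} (hB : ∀ u, |e u| ≤ B)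
    (h : ∀ u, crossSum 1 e u = l * e u) (k : ℕ) (hk : k ≠ 0)
    (hkp : ∀ p : ℕ, p.Prime → p ∣ k → (4 + |l|) * B < p) :
    ∀ u, crossSum k e u = l * e u := by
  induction k using Nat.recOnMul generalizing e with
  | zero => exact absurd rfl hk
  | one => exact_mod_cast h
  | prime p hp => exact crossSum_prime_of_bounded hB h hp (hkp p hp dvd_rfl)
  | mul m n ihm ihn =>
    intro u
    have hm := ihm hB h (left_ne_zero_of_mul hk) fun p hp hd => hkp p hp (hd.mul_right n)
    have hn := ihn (e := fun v => e (u + (m : ℤ) • v)) (fun v => hB _)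
      (fun v => by
        have := hm (u + (m : ℤ) • v)
        simpa [crossSum, smul_add, add_assoc] using this)
      (right_ne_zero_of_mul hk) (fun p hp hd => hkp p hp (hd.mul_left m)) 0
    simpa [crossSum] using hn

/-! ### Differences of bounded functions -/

/-- A bounded integer function with vanishing second difference along `r` is `r`-periodic: along
`r` it is affine, hence constant. -/
theorem periodic_of_second_difference {h : ℤ × ℤ → ℤ} {B : ℤ} (hB : ∀ u, |h u| ≤ B)
    {r : ℤ × ℤ} (hr : ∀ u, h (u + r + r) - h (u + r) = h (u + r) - h u) (u : ℤ × ℤ) :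
    h (u + r) = h u := by
  have hdiff : ∀ n : ℕ, h (u + n • r + r) - h (u + n • r) = h (u + r) - h u := by
    intro n
    induction n with
    | zero => simp
    | succ n ih => rw [succ_nsmul, ← add_assoc, hr, ih]
  have haff : ∀ n : ℕ, h (u + n • r) = h u + n * (h (u + r) - h u) := by
    intro n
    induction n with
    | zero => simp
    | succ n ih =>
      have := hdiff n
      rw [succ_nsmul, ← add_assoc]
      push_cast
      linarith
  by_contra hne
  have hB0 : 0 ≤ B := (abs_nonneg _).trans (hB u)
  have h1 := haff (2 * B + 1).toNat
  have h2 := hB (u + (2 * B + 1).toNat • r)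
  have h3 := hB u
  have h4 : 1 ≤ |h (u + r) - h u| := Int.one_le_abs (sub_ne_zero.mpr hne)
  have h5 : |((2 * B + 1).toNat : ℤ) * (h (u + r) - h u)| ≤ 2 * B := by
    rw [← sub_eq_iff_eq_add'] at h1
    rw [← h1]
    exact (abs_sub _ _).trans (by linarith)
  rw [abs_mul, Int.toNat_of_nonneg (by linarith), abs_of_nonneg (by linarith)] at h5
  nlinarith

theorem periodic_nsmul {A : Type*} {h : ℤ × ℤ → A} {t : ℤ × ℤ} (ht : ∀ u, h (u + t) = h u)
    (n : ℕ) (u : ℤ × ℤ) : h (u + n • t) = h u := by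
  induction n with
  | zero => simp
  | succ n ih => rw [succ_nsmul, ← add_assoc, ht, ih]

/-- If a difference of a bounded integer function along `s` is `t`-periodic, the function is
periodic by every common multiple of `s` and `t`. -/
theorem periodic_of_periodic_difference {h : ℤ × ℤ → ℤ} {B : ℤ} (hB : ∀ u, |h u| ≤ B)
    {s t r : ℤ × ℤ} (hst : ∀ u, h (u + t + s) - h (u + t) = h (u + s) - h u)
    {m n : ℕ} (hm : r = m • s) (hn : r = n • t) (u : ℤ × ℤ) : h (u + r) = h u := by
  refine periodic_of_second_difference hB (fun u => ?_) u
  -- First replace `t` by its multiple `r`, then `s` by its multiple `r`.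
  have h1 : ∀ v, h (v + r + s) - h (v + r) = h (v + s) - h v := by
    intro v
    have := periodic_nsmul (h := fun u => h (u + s) - h u) hst n v
    rwa [← hn] at this
  have h2 : ∀ v, h (v + s + r) - h (v + s) = h (v + r) - h v := by
    intro v
    have := h1 v
    rw [add_right_comm] at this
    linarith
  have := periodic_nsmul (h := fun u => h (u + r) - h u) h2 m u
  rwa [← hm] at this

/-! ### Averaging over dilations -/

/-- The telescoping estimate: when the eigenvalue is nonzero, averaging the equations for
`crossSum (1 + M * j)` over `j` kills the mixed difference with steps `M` along the two axes. -/
theorem mixed_difference_eq_zero {e : ℤ × ℤ → ℤ} {l B : ℤ} (hl : l ≠ 0) (hB : ∀ u, |e u| ≤ B)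
    (M : ℤ) (h : ∀ (j : ℕ) u, crossSum (1 + M * j) e u = l * e u) (u : ℤ × ℤ) :
    e (u + (M, M)) - e (u + (M, 0)) = e (u + (0, M)) - e u := by
  obtain ⟨x, y⟩ := u
  have hsum : ∀ J : ℕ, l * J * (e (x + M, y + M) - e (x + M, y) - e (x, y + M) + e (x, y)) =
      (e (x + (1 + M * J), y + M) - e (x + (1 + M * J), y))
        - (e (x + 1, y + M) - e (x + 1, y))
      + ((e (x - 1 + M, y + M) - e (x - 1 + M, y))
        - (e (x - 1 + M - M * J, y + M) - e (x - 1 + M - M * J, y)))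
      + ((e (x + M, y + (1 + M * J)) - e (x, y + (1 + M * J)))
        - (e (x + M, y + 1) - e (x, y + 1)))
      + ((e (x + M, y - 1 + M) - e (x, y - 1 + M))
        - (e (x + M, y - 1 + M - M * J) - e (x, y - 1 + M - M * J))) := by
    intro J
    induction J with
    | zero => simp
    | succ J ih =>
      have a1 := h J (x + M, y + M)
      have a2 := h J (x + M, y)
      have a3 := h J (x, y + M)
      have a4 := h J (x, y)
      simp only [crossSum, Prod.mk_add_mk, add_zero] at a1 a2 a3 a4
      push_cast
      ring_nf at a1 a2 a3 a4 ih ⊢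
      linarith
  by_contra hne
  have hB0 : 0 ≤ B := (abs_nonneg _).trans (hB 0)
  set F := e (x + M, y + M) - e (x + M, y) - e (x, y + M) + e (x, y) with hF
  have hF0 : F ≠ 0 := by
    intro h0
    apply hne
    simp only [Prod.mk_add_mk, add_zero]
    linarith
  have h1 : 1 ≤ |l * F| := Int.one_le_abs (mul_ne_zero hl hF0)
  have h2 := hsum (16 * B + 1).toNat
  have h3 : |l * (16 * B + 1).toNat * F| ≤ 16 * B := by
    rw [h2]
    generalize ((16 * B + 1).toNat : ℤ) = J
    have hB' := fun x y => abs_le.mp (hB (x, y))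
    have b1 := hB' (x + (1 + M * J)) (y + M)
    have b2 := hB' (x + (1 + M * J)) y
    have b3 := hB' (x + 1) (y + M)
    have b4 := hB' (x + 1) y
    have b5 := hB' (x - 1 + M) (y + M)
    have b6 := hB' (x - 1 + M) y
    have b7 := hB' (x - 1 + M - M * J) (y + M)
    have b8 := hB' (x - 1 + M - M * J) y
    have c1 := hB' (x + M) (y + (1 + M * J))
    have c2 := hB' x (y + (1 + M * J))
    have c3 := hB' (x + M) (y + 1)
    have c4 := hB' x (y + 1)
    have c5 := hB' (x + M) (y - 1 + M)
    have c6 := hB' x (y - 1 + M)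
    have c7 := hB' (x + M) (y - 1 + M - M * J)
    have c8 := hB' x (y - 1 + M - M * J)
    rw [abs_le]
    constructor <;> linarith
  rw [mul_right_comm, abs_mul, Int.toNat_of_nonneg (by linarith),
    abs_of_nonneg (a := 16 * B + 1) (by linarith)] at h3
  nlinarith

/-! ### Periods of eigenfunctions -/

/-- Two consecutive rows determine an eigenfunction of `crossSum 1`. -/
theorem eq_zero_of_rows {e : ℤ × ℤ → ℤ} {l : ℤ} (h : ∀ u, crossSum 1 e u = l * e u) {n : ℤ}
    (h0 : ∀ x, e (x, n) = 0) (h1 : ∀ x, e (x, n + 1) = 0) : e = 0 := by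
  have hrec : ∀ x y, e (x + 1, y) + e (x - 1, y) + e (x, y + 1) + e (x, y - 1) = l * e (x, y) := by
    intro x y
    simpa [crossSum, ← sub_eq_add_neg] using h (x, y)
  have key : ∀ k : ℤ, (∀ x, e (x, n + k) = 0) ∧ ∀ x, e (x, n + k + 1) = 0 := by
    intro k
    induction k using Int.induction_on with
    | zero => simpa using ⟨h0, h1⟩
    | succ k ih =>
      rw [← add_assoc]
      refine ⟨ih.2, fun x => ?_⟩
      have := hrec x (n + k + 1)
      simpa [ih.1, ih.2] using this
    | pred k ih =>
      rw [show n + (-(k : ℤ) - 1) + 1 = n + -k by ring]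
      refine ⟨fun x => ?_, ih.1⟩
      have := hrec x (n + -k)
      simpa [ih.1, ih.2, add_sub_assoc] using this
  funext ⟨x, y⟩
  simpa using (key (y - n)).1 x

/-- A bounded horizontally periodic eigenfunction of `crossSum 1` is vertically periodic: among
the finitely many pairs of consecutive rows one repeats, and it determines the function. -/
theorem exists_vertical_period {g : ℤ × ℤ → ℤ} {l B : ℤ} (hB : ∀ u, |g u| ≤ B)
    (h : ∀ u, crossSum 1 g u = l * g u) {M : ℕ} (hM : M ≠ 0)
    (hp : ∀ u, g (u + ((M : ℤ), 0)) = g u) :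
    ∃ T : ℕ, T ≠ 0 ∧ ∀ u, g (u + (0, (T : ℤ))) = g u := by
  let state : ℕ → Fin M → Set.Icc (-B) B × Set.Icc (-B) B := fun n i =>
    (⟨g (i, n), abs_le.mp (hB _)⟩, ⟨g (i, n + 1), abs_le.mp (hB _)⟩)
  obtain ⟨n, n', hne, heq⟩ := Finite.exists_ne_map_eq_of_infinite state
  wlog hlt : n < n' generalizing n n'
  · exact this n' n hne.symm heq.symm (by omega)
  have hred : ∀ x y : ℤ, g (x, y) = g (x % M, y) := by
    intro x y
    have hz : ∀ k : ℤ, ∀ x, g (x + k * M, y) = g (x, y) := by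
      intro k
      induction k using Int.induction_on with
      | zero => simp
      | succ k ih =>
        intro x
        have := hp (x + k * M, y)
        rw [← ih x, ← this]
        simp [add_mul, add_assoc]
      | pred k ih =>
        intro x
        have := hp (x + (-k - 1) * M, y)
        rw [← ih x, ← this]
        simp only [Prod.mk_add_mk, add_zero]
        congr 2
        ring
    rw [← hz (x / M) (x % M), mul_comm, Int.emod_add_mul_ediv]
  have hrow : ∀ x : ℤ, g (x, n) = g (x, n') ∧ g (x, n + 1) = g (x, n' + 1) := by
    intro x
    have hM' : (0 : ℤ) < M := by omega
    have hx0 := Int.emod_nonneg x hM'.ne'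
    have hx1 := Int.emod_lt_of_pos x hM'
    have := congrFun heq ⟨(x % M).toNat, by omega⟩
    simp only [state, Prod.mk.injEq, Subtype.mk.injEq, Int.toNat_of_nonneg hx0] at this
    rw [hred x n, hred x n', hred x (n + 1), hred x (n' + 1)]
    exact this
  refine ⟨n' - n, by omega, ?_⟩
  have hcast : ((n' - n : ℕ) : ℤ) = n' - n := by omega
  have hzero := eq_zero_of_rows (e := fun u => g (u + (0, ((n' - n : ℕ) : ℤ))) - g u) (l := l)
    (n := n) (fun u => by
      have h1 := h u
      have h2 := h (u + (0, ((n' - n : ℕ) : ℤ)))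
      simp only [crossSum] at h1 h2 ⊢
      simp only [add_right_comm _ ((0 : ℤ), ((n' - n : ℕ) : ℤ))] at h2
      linarith)
    (fun x => by simp [hcast, (hrow x).1])
    (fun x => by
      rw [(hrow x).2, sub_eq_zero, hcast]
      simp only [Prod.mk_add_mk, add_zero]
      congr 2
      ring)
  exact fun u => sub_eq_zero.mp (congrFun hzero u)

theorem exists_vertical_period_of_eigen {e : ℤ × ℤ → ℤ} {l B : ℤ} (hl : l ≠ 0)
    (hB : ∀ u, |e u| ≤ B) (h : ∀ u, crossSum 1 e u = l * e u) :
    ∃ T : ℕ, T ≠ 0 ∧ ∀ u, e (u + (0, (T : ℤ))) = e u := by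
  -- Every number `1 + M * j` is prime to all the primes up to the bound for Frobenius.
  set N := ((4 + |l|) * B).toNat with hN
  set M := N.factorial with hM
  have hcross : ∀ (j : ℕ) u, crossSum (1 + (M : ℤ) * j) e u = l * e u := by
    intro j u
    have := crossSum_of_coprime hB h (1 + M * j) (by omega) (fun p hp hd => by
      have hlt : N < p := by
        by_contra! hle
        have h1 : p ∣ M * j := ((hp.dvd_factorial).mpr hle).mul_right j
        exact hp.one_lt.ne' (Nat.dvd_one.mp ((Nat.dvd_add_left h1).mp hd))
      have : ((4 + |l|) * B) ≤ N := Int.self_le_toNat _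
      omega) u
    exact_mod_cast this
  have hmix := mixed_difference_eq_zero hl hB M hcross
  have hM0 : M ≠ 0 := N.factorial_ne_zero
  obtain ⟨T, hT, hper⟩ := exists_vertical_period
    (g := fun u => e (u + (0, (M : ℤ))) - e u) (l := l) (B := 2 * B)
    (fun u => (abs_sub _ _).trans (by linarith [hB u, hB (u + (0, (M : ℤ)))]))
    (fun u => by
      have h1 := h u
      have h2 := h (u + (0, (M : ℤ)))
      simp only [crossSum] at h1 h2 ⊢
      simp only [add_right_comm _ ((0 : ℤ), (M : ℤ))] at h2
      linarith)
    hM0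
    (fun u => by
      have := hmix u
      simp only [add_assoc, Prod.mk_add_mk, add_zero, zero_add]
      linarith)
  refine ⟨T * M, mul_ne_zero hT hM0, fun u => ?_⟩
  exact periodic_of_periodic_difference hB hper (m := T) (n := M) (by simp)
    (by simp [mul_comm]) u

theorem exists_horizontal_period_of_eigen {e : ℤ × ℤ → ℤ} {l B : ℤ} (hl : l ≠ 0)
    (hB : ∀ u, |e u| ≤ B) (h : ∀ u, crossSum 1 e u = l * e u) :
    ∃ T : ℕ, T ≠ 0 ∧ ∀ u, e (u + ((T : ℤ), 0)) = e u := by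
  obtain ⟨T, hT, hper⟩ := exists_vertical_period_of_eigen (e := fun u => e u.swap) hl
    (fun u => hB _) (fun u => by
      rw [← h u.swap]
      simp only [crossSum, Prod.swap_add, Prod.swap_prod_mk]
      ring)
  exact ⟨T, hT, fun u => by simpa using hper u.swap⟩

/-- An inhomogeneous eigenfunction is reduced to the homogeneous case by taking differences along
the axes, which removes the constant for every eigenvalue, including `4`. -/
theorem exists_axis_periods {n : ℤ × ℤ → ℤ} {l k B : ℤ} (hl : l ≠ 0) (hB : ∀ u, |n u| ≤ B)
    (h : ∀ u, crossSum 1 n u = l * n u + k) :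
    ∃ S T : ℕ, S ≠ 0 ∧ T ≠ 0 ∧ (∀ u, n (u + ((S : ℤ), 0)) = n u) ∧
      ∀ u, n (u + (0, (T : ℤ))) = n u := by
  have hdB : ∀ s u, |n (u + s) - n u| ≤ 2 * B := fun s u =>
    (abs_sub _ _).trans (by linarith [hB u, hB (u + s)])
  have hd : ∀ s u, crossSum 1 (fun v => n (v + s) - n v) u = l * (n (u + s) - n u) := by
    intro s u
    have h1 := h u
    have h2 := h (u + s)
    simp only [crossSum] at h1 h2 ⊢
    simp only [add_right_comm _ s] at h2
    linarith
  obtain ⟨S, hS, hSp⟩ := exists_horizontal_period_of_eigen hl (hdB (1, 0)) (hd (1, 0))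
  obtain ⟨T, hT, hTp⟩ := exists_vertical_period_of_eigen hl (hdB (0, 1)) (hd (0, 1))
  refine ⟨S, T, hS, hT, fun u => ?_, fun u => ?_⟩
  · exact periodic_of_periodic_difference hB hSp (m := S) (n := 1) (by simp) (by simp) u
  · exact periodic_of_periodic_difference hB hTp (m := T) (n := 1) (by simp) (by simp) u

/-! ### Coverings -/

theorem isPeriodicBy_of_add {A : Type*} {c : ℤ × ℤ → A} {t : ℤ × ℤ}
    (h : ∀ u, c (u + t) = c u) : IsPeriodicBy c t :=
  funext fun u => by simpa [translate] using (h (u - t)).symm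

theorem isTwoPeriodic_of_axis_periods {A : Type*} {c : ℤ × ℤ → A} {S T : ℤ} (hS : S ≠ 0)
    (hT : T ≠ 0) (h1 : ∀ u, c (u + (S, 0)) = c u) (h2 : ∀ u, c (u + (0, T)) = c u) :
    IsTwoPeriodic c := by
  refine ⟨(S, 0), (0, T), ?_, isPeriodicBy_of_add h1, isPeriodicBy_of_add h2⟩
  rw [LinearIndependent.pair_iff]
  intro p q hpq
  simpa [hS, hT] using hpq

/-- The closed unit ball of the square grid. -/
def cross : Finset (ℤ × ℤ) := {(0, 0), (1, 0), (-1, 0), (0, 1), (0, -1)}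

theorem eq_cross {D : Finset (ℤ × ℤ)} (hD : (D : Set (ℤ × ℤ)) = neighborhood squareGrid 1 (0, 0)) :
    D = cross := by
  ext ⟨x, y⟩
  rw [← Finset.mem_coe, hD]
  simp only [neighborhood, Set.mem_ofPred_eq, Nat.cast_one, SimpleGraph.edist_le_one_iff_adj_or_eq]
  simp [squareGrid, cross]
  tauto

theorem sum_cross {R : Type*} [AddCommMonoid R] (g : ℤ × ℤ → R) :
    ∑ d ∈ cross, g d = g 0 + (g (1, 0) + g (-1, 0) + g (0, 1) + g (0, -1)) := by
  simp [cross, add_assoc]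
  rfl

/-- The number of ones in the unit ball around `u`, computed in two ways. -/
theorem crossSum_of_isCovering {b a : ℕ} {c : BinaryConfig} (hc : IsCovering cross b a c)
    (u : ℤ × ℤ) : crossSum 1 (fun v => ((c v : ℕ) : ℤ)) u =
      ((b : ℤ) - a - 1) * ((c u : ℕ) : ℤ) + a := by
  have hcard : (((cross.filter fun d => c (u + d) = 1).card : ℕ) : ℤ) =
      ∑ d ∈ cross, ((c (u + d) : ℕ) : ℤ) := by
    rw [Finset.card_filter, Nat.cast_sum]
    refine Finset.sum_congr rfl fun d _ => ?_
    generalize c (u + d) = i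
    fin_cases i <;> rfl
  have hsum : ∑ d ∈ cross, ((c (u + d) : ℕ) : ℤ) =
      ((c u : ℕ) : ℤ) + crossSum 1 (fun v => ((c v : ℕ) : ℤ)) u := by
    simp [sum_cross, crossSum]
  obtain ⟨h1, h0⟩ := hc u
  rw [hsum] at hcard
  rcases (by omega : c u = 0 ∨ c u = 1) with hcu | hcu
  · rw [h0 hcu, hcu] at hcard
    simp [hcu, hcard]
  · rw [h1 hcu, hcu] at hcard
    simp [hcu, hcard]
    ring

theorem mulSeries_eq_sum (f : LaurentPoly) (c : Series) (u : ℤ × ℤ) :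
    mulSeries f c u = f.coeff.sum fun w z => z * c (u - w) := rfl

theorem mulSeries_add (f g : LaurentPoly) (c : Series) :
    mulSeries (f + g) c = mulSeries f c + mulSeries g c := by
  ext u
  simp only [mulSeries_eq_sum, Pi.add_apply, AddMonoidAlgebra.coeff_add]
  exact Finsupp.sum_add_index' (by simp) (by intros; ring)

theorem mulSeries_single (w : ℤ × ℤ) (z : ℂ) (c : Series) (u : ℤ × ℤ) :
    mulSeries (.single w z) c u = z * c (u - w) := by
  rw [mulSeries_eq_sum, AddMonoidAlgebra.coeff_single, Finsupp.sum_single_index (by simp)]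

theorem coveringPoly_cross (b a : ℕ) : coveringPoly cross b a =
    crossPoly ℂ 1 + .single 0 (1 - ((b : ℂ) - a)) := by
  rw [sub_eq_add_neg 1, AddMonoidAlgebra.single_add, AddMonoidAlgebra.single_neg]
  simp only [coveringPoly, charPoly, sum_cross, crossPoly, Prod.neg_mk, neg_neg, neg_zero]
  abel

theorem mulSeries_coveringPoly {b a : ℕ} {c : BinaryConfig} (hc : IsCovering cross b a c) :
    mulSeries (coveringPoly cross b a) (BinaryConfig.toSeries c) = fun _ => (a : ℂ) := by
  ext u
  have h := congrArg (Int.cast : ℤ → ℂ) (crossSum_of_isCovering hc u)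
  simp only [crossSum] at h
  push_cast at h
  simp only [coveringPoly_cross, crossPoly, mulSeries_add, Pi.add_apply, mulSeries_single,
    BinaryConfig.toSeries, sub_eq_add_neg, Prod.neg_mk, neg_neg, neg_zero, add_zero] at h ⊢
  linear_combination h

/-! ### Line polynomial factors -/

/-- A divisor of a monomial is a monomial: if two factors have more than one pair of terms
altogether, at least two products of exponents are attained only once. -/
theorem card_support_le_one_of_dvd_single {φ : LaurentPoly} {u : ℤ × ℤ} {z : ℂ} (hz : z ≠ 0)
    (h : φ ∣ .single u z) : φ.coeff.support.card ≤ 1 := by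
  obtain ⟨g, hg⟩ := h
  have hne : φ * g ≠ 0 := by rw [← hg]; simpa using hz
  have hg0 : 0 < g.coeff.support.card := by
    rw [Finset.card_pos, Finsupp.support_nonempty_iff]
    simpa using right_ne_zero_of_mul hne
  by_contra! hcard
  obtain ⟨p, hp, q, hq, hpq, hup, huq⟩ :=
    TwoUniqueSums.uniqueAdd_of_one_lt_card (A := φ.coeff.support) (B := g.coeff.support)
      (by nlinarith)
  rw [Finset.mem_product] at hp hq
  have key : ∀ r : (ℤ × ℤ) × (ℤ × ℤ), r.1 ∈ φ.coeff.support → r.2 ∈ g.coeff.support →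
      UniqueAdd φ.coeff.support g.coeff.support r.1 r.2 → r.1 + r.2 = u := by
    intro r h1 h2 hr
    have hcoeff := AddMonoidAlgebra.coeff_mul_add_of_uniqueAdd hr
    rw [← hg, AddMonoidAlgebra.coeff_single, Finsupp.single_apply] at hcoeff
    by_contra hru
    rw [if_neg (Ne.symm hru)] at hcoeff
    exact mul_ne_zero (Finsupp.mem_support_iff.mp h1) (Finsupp.mem_support_iff.mp h2) hcoeff.symm
  have := huq hp.1 hp.2 ((key p hp.1 hp.2 hup).trans (key q hq.1 hq.2 huq).symm)
  exact hpq (Prod.ext this.1 this.2)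

/-- The grading of Laurent polynomials by an additive function `ℓ` on exponents, as a ring
homomorphism: the coefficient of the image of `f` at `n` is the part of `f` supported on
`ℓ = n`. -/
noncomputable def gradingHom (ℓ : ℤ × ℤ →+ ℤ) : LaurentPoly →ₐ[ℂ] AddMonoidAlgebra LaurentPoly ℤ :=
  AddMonoidAlgebra.lift ℂ _ (ℤ × ℤ)
    { toFun := fun u => .single (ℓ u.toAdd) (.single u.toAdd 1)
      map_one' := by simp only [toAdd_one, map_zero, AddMonoidAlgebra.one_def]
      map_mul' := fun u v => by
        simp only [toAdd_mul, map_add, AddMonoidAlgebra.single_mul_single, mul_one] }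

theorem gradingHom_single (ℓ : ℤ × ℤ →+ ℤ) (u : ℤ × ℤ) (z : ℂ) :
    gradingHom ℓ (.single u z) = .single (ℓ u) (.single u z) := by
  simp [gradingHom, AddMonoidAlgebra.lift_single, -LaurentPolynomial.single_eq_C_mul_T]

/-- A polynomial that is homogeneous for `ℓ` divides every homogeneous component of its
multiples. -/
theorem dvd_component_of_dvd {ℓ : ℤ × ℤ →+ ℤ} {φ f : LaurentPoly} {m : ℤ}
    (hφ : ∀ w ∈ φ.coeff.support, ℓ w = m) (h : φ ∣ f) (n : ℤ) :
    φ ∣ (gradingHom ℓ f).coeff n := by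
  obtain ⟨g, rfl⟩ := h
  have hsingle : gradingHom ℓ φ = .single m φ := by
    conv_lhs => rw [← AddMonoidAlgebra.sum_coeff_single φ]
    conv_rhs => rw [← AddMonoidAlgebra.sum_coeff_single φ]
    simp only [Finsupp.sum, map_sum]
    have : ∀ s : Finset (ℤ × ℤ), (AddMonoidAlgebra.single m
        (∑ w ∈ s, AddMonoidAlgebra.single w (φ.coeff w)) : AddMonoidAlgebra LaurentPoly ℤ) =
        ∑ w ∈ s, .single m (.single w (φ.coeff w)) := fun s =>
      map_sum (AddMonoidAlgebra.singleAddHom m) _ s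
    rw [this]
    exact Finset.sum_congr rfl fun w hw => by rw [gradingHom_single, hφ w hw]
  rw [map_mul, hsingle, AddMonoidAlgebra.coeff_single_mul_apply]
  exact dvd_mul_right _ _

theorem not_isLinePolynomial_of_dvd {l : ℂ} (hl : l ≠ 0) {φ : LaurentPoly}
    (h : φ ∣ crossPoly ℂ 1 + .single 0 l) : ¬ IsLinePolynomial φ := by
  rintro ⟨hcard, u, v, hline⟩
  -- A functional vanishing on the direction `v` is constant on the support of `φ`.
  have hconst : ∀ p q : ℤ, p * v.1 + q * v.2 = 0 → ∀ w ∈ φ.coeff.support,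
      p * w.1 + q * w.2 = p * u.1 + q * u.2 := by
    intro p q hpq w hw
    obtain ⟨r, h1, h2⟩ := hline w hw
    have hpq' : (p : ℚ) * v.1 + q * v.2 = 0 := by exact_mod_cast hpq
    have : (p : ℚ) * w.1 + q * w.2 = p * u.1 + q * u.2 := by
      rw [h1, h2]; linear_combination r * hpq'
    exact_mod_cast this
  have hmono : ∀ p q n : ℤ, p * v.1 + q * v.2 = 0 → ∀ w z, z ≠ 0 →
      (gradingHom (p • AddMonoidHom.fst ℤ ℤ + q • AddMonoidHom.snd ℤ ℤ)
        (crossPoly ℂ 1 + .single 0 l)).coeff n ≠ .single w z := by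
    intro p q n hpq w z hz heq
    have hd := dvd_component_of_dvd (ℓ := p • AddMonoidHom.fst ℤ ℤ + q • AddMonoidHom.snd ℤ ℤ)
      (m := p * u.1 + q * u.2) (fun w hw => by simpa using hconst p q hpq w hw) h n
    rw [heq] at hd
    have := card_support_le_one_of_dvd_single hz hd
    omega
  -- A monomial component: `y` or `x` in the axial directions, the constant term otherwise.
  by_cases hv2 : v.2 = 0
  · refine hmono 0 1 1 (by simp [hv2]) (0, 1) 1 one_ne_zero ?_
    simp [crossPoly, gradingHom_single, -LaurentPolynomial.single_eq_C_mul_T]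
  · by_cases hv1 : v.1 = 0
    · refine hmono 1 0 1 (by simp [hv1]) (1, 0) 1 one_ne_zero ?_
      simp [crossPoly, gradingHom_single, -LaurentPolynomial.single_eq_C_mul_T]
    · refine hmono v.2 (-v.1) 0 (by ring) 0 l hl ?_
      simp [crossPoly, gradingHom_single, -LaurentPolynomial.single_eq_C_mul_T, hv1, hv2]

end GridCovering

theorem mainTheorem4 (D : Finset (ℤ × ℤ))
    (hD : (D : Set (ℤ × ℤ)) = GridCovering.neighborhood GridCovering.squareGrid 1 (0, 0))
    (b a : ℕ) (hab : (b : ℤ) - (a : ℤ) ≠ 1) :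
    (∀ c : GridCovering.BinaryConfig, GridCovering.IsCovering D b a c →
      GridCovering.IsTwoPeriodic c ∧
      GridCovering.IsPeriodizer (GridCovering.coveringPoly D b a)
        (GridCovering.BinaryConfig.toSeries c)) ∧
    ¬ ∃ φ : GridCovering.LaurentPoly,
      GridCovering.IsLinePolynomial φ ∧ φ ∣ GridCovering.coveringPoly D b a := by
  obtain rfl := GridCovering.eq_cross hD
  refine ⟨fun c hc => ⟨?_, ?_⟩, ?_⟩
  · obtain ⟨S, T, hS, hT, h1, h2⟩ :=
      GridCovering.exists_axis_periods (B := 1) (sub_ne_zero.mpr hab)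
      (fun u => by rw [abs_le]; constructor <;> omega) (GridCovering.crossSum_of_isCovering hc)
    exact GridCovering.isTwoPeriodic_of_axis_periods (Nat.cast_ne_zero.mpr hS)
      (Nat.cast_ne_zero.mpr hT)
      (fun u => Fin.ext (Int.ofNat_inj.mp (h1 u))) (fun u => Fin.ext (Int.ofNat_inj.mp (h2 u)))
  · rw [GridCovering.IsPeriodizer, GridCovering.mulSeries_coveringPoly hc]
    exact GridCovering.isTwoPeriodic_of_axis_periods one_ne_zero one_ne_zero (fun _ => rfl)
      (fun _ => rfl)
  · rintro ⟨φ, hφ, hdvd⟩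
    rw [GridCovering.coveringPoly_cross] at hdvd
    refine GridCovering.not_isLinePolynomial_of_dvd (fun h => hab ?_) hdvd hφ
    exact_mod_cast (sub_eq_zero.mp h).symm
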